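/- Let $M$ be a smooth manifold and $(J,g,\theta)$ a quasi-Vaisman structure on $M$. That is, $(J,g)$ is a Hermitian structure ($J$ is a $(1,1)$-tensor field and $g$ a Riemannian metric with $J^2=-\mathrm{Id}$, $g(JX,JY)=g(X,Y)$ and vanishing Nijenhuis torsion $N_J=0$), $\theta$ is a closed $1$-form whose metric dual vector field $U$ has length one and is Killing, and $$\mathcal L_U J=0,\qquad d\Omega=d\eta\wedge\theta,$$ where $\Omega(X,Y)=g(X,JY)$ and $\eta=-\theta\circ J$. Let $V$ be the metric dual of $\eta$. Then the distribution $\ker\theta=\langle U\rangle^{\perp}$ is involutive, hence integrable. Moreover, let $L$ be a leaf of the foliation $\ker\theta$, that is, a maximal connected injectively immersed integral manifold. Then $L$ carries tensors $(\phi,\xi,\eta,g)$, where $\xi=V$, where $\eta$ and $g$ are the restrictions to $L$ of $\eta$ and $g$, and where $\phi$ is given by $$\phi\,\xi=0,\qquad \phi X=JX\ \text{ for } X\in\langle U,V\rangle^{\perp}.$$ These tensors form an almost contact metric structure on $L$, that is, they are smooth, $g$ is a Riemannian metric, and $$\phi^2=-\mathrm{Id}+\eta\otimes\xi,\qquad \eta(\xi)=1,\qquad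 g(\phi X,\phi Y)=g(X,Y)-\eta(X)\eta(Y).$$ This structure is quasi-Sasakian: it is normal, $N_\phi+d\eta\otimes\xi=0$, and the $2$-form $\Phi(X,Y)=g(X,\phi Y)$ satisfies $d\Phi=0$. Here $N_A(X,Y)=A^2[X,Y]+[AX,AY]-A([AX,Y]+[X,AY])$ and $d\eta(X,Y)=X(\eta(Y))-Y(\eta(X))-\eta([X,Y])$. -/

import Mathlib

open scoped Manifold ContDiff Topology Bundle
open Bundle VectorField

noncomputable section

namespace LeafGeometry

section Tensors

variable {E : Type*} [NormedAddCommGroup E] [NormedSpace ℝ E]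
  {M : Type*} [TopologicalSpace M] [ChartedSpace E M]

/-- A (rough) vector field: a tangent vector at every point. -/
abbrev VField (E : Type*) [NormedAddCommGroup E] [NormedSpace ℝ E]
    (M : Type*) [TopologicalSpace M] [ChartedSpace E M] :=
  Π x : M, TangentSpace 𝓘(ℝ, E) x

/-- A (rough) field of covectors. -/
abbrev CovField (E : Type*) [NormedAddCommGroup E] [NormedSpace ℝ E]
    (M : Type*) [TopologicalSpace M] [ChartedSpace E M] :=
  Π x : M, TangentSpace 𝓘(ℝ, E) x →L[ℝ] ℝ

/-- A (rough) field of endomorphisms of the tangent bundle. -/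
abbrev EndField (E : Type*) [NormedAddCommGroup E] [NormedSpace ℝ E]
    (M : Type*) [TopologicalSpace M] [ChartedSpace E M] :=
  Π x : M, TangentSpace 𝓘(ℝ, E) x →L[ℝ] TangentSpace 𝓘(ℝ, E) x

/-- A (rough) field of two-covariant tensors, as a function of two tangent vectors. -/
abbrev TwoField (E : Type*) [NormedAddCommGroup E] [NormedSpace ℝ E]
    (M : Type*) [TopologicalSpace M] [ChartedSpace E M] :=
  Π x : M, TangentSpace 𝓘(ℝ, E) x → TangentSpace 𝓘(ℝ, E) x → ℝ

variable [IsManifold 𝓘(ℝ, E) ∞ M]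

/-- Smooth Riemannian metrics on `M`. -/
abbrev RMetric (E : Type*) [NormedAddCommGroup E] [NormedSpace ℝ E]
    (M : Type*) [TopologicalSpace M] [ChartedSpace E M] [IsManifold 𝓘(ℝ, E) ∞ M] :=
  ContMDiffRiemannianMetric 𝓘(ℝ, E) ∞ E (fun x : M => TangentSpace 𝓘(ℝ, E) x)

/-- The vector field `X` is smooth at `p`. Identities between tensor fields are tested at each
point `p` on vector fields that are smooth at `p`. -/
def SmoothAt (X : VField E M) (p : M) : Prop :=
  ContMDiffAt 𝓘(ℝ, E) 𝓘(ℝ, E).tangent ∞ (fun x => (X x : TangentBundle 𝓘(ℝ, E) M)) p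

/-- The vector field `X` is smooth. -/
def SmoothVField (X : VField E M) : Prop :=
  ContMDiff 𝓘(ℝ, E) 𝓘(ℝ, E).tangent ∞ (fun x => (X x : TangentBundle 𝓘(ℝ, E) M))

/-- The 1-form `α` is smooth, as a section of the cotangent bundle. -/
def SmoothCovField (α : CovField E M) : Prop :=
  ContMDiff 𝓘(ℝ, E) (𝓘(ℝ, E).prod 𝓘(ℝ, E →L[ℝ] ℝ)) ∞
    (fun x => TotalSpace.mk' (E →L[ℝ] ℝ)
      (E := fun x : M => TangentSpace 𝓘(ℝ, E) x →L[ℝ] Bundle.Trivial M ℝ x) x (α x))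

/-- The (1,1)-tensor field `A` is smooth, as a section of the endomorphism bundle. -/
def SmoothEndField (A : EndField E M) : Prop :=
  ContMDiff 𝓘(ℝ, E) (𝓘(ℝ, E).prod 𝓘(ℝ, E →L[ℝ] E)) ∞
    (fun x => TotalSpace.mk' (E →L[ℝ] E)
      (E := fun x : M => TangentSpace 𝓘(ℝ, E) x →L[ℝ] TangentSpace 𝓘(ℝ, E) x) x (A x))

/-- The Lie bracket `[X, Y]`. -/
abbrev bracket (X Y : VField E M) : VField E M := mlieBracket 𝓘(ℝ, E) X Y

/-- The vector field `A X`. -/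
abbrev app (A : EndField E M) (X : VField E M) : VField E M := fun x => A x (X x)

/-- The derivative `X(f)` of the function `f` along the vector field `X`. -/
def der (X : VField E M) (f : M → ℝ) : M → ℝ :=
  fun x => mfderiv 𝓘(ℝ, E) 𝓘(ℝ, ℝ) f x (X x)

/-- The exterior derivative of a 1-form:
`dα(X, Y) = X(α(Y)) - Y(α(X)) - α([X, Y])`. -/
def dOne (α : CovField E M) (X Y : VField E M) (p : M) : ℝ :=
  der X (fun x => α x (Y x)) p - der Y (fun x => α x (X x)) p - α p (bracket X Y p)

/-- The exterior derivative of a 2-form: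
`dΩ(X, Y, Z) = X(Ω(Y, Z)) + Y(Ω(Z, X)) + Z(Ω(X, Y)) - Ω([X, Y], Z) - Ω([Y, Z], X) - Ω([Z, X], Y)`.
-/
def dTwo (Ω : TwoField E M) (X Y Z : VField E M) (p : M) : ℝ :=
  der X (fun x => Ω x (Y x) (Z x)) p + der Y (fun x => Ω x (Z x) (X x)) p
    + der Z (fun x => Ω x (X x) (Y x)) p
    - Ω p (bracket X Y p) (Z p) - Ω p (bracket Y Z p) (X p) - Ω p (bracket Z X p) (Y p)

/-- The 3-form `dα ∧ β`, for 1-forms `α` and `β`. -/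
def dOneWedge (α β : CovField E M) (X Y Z : VField E M) (p : M) : ℝ :=
  dOne α X Y p * β p (Z p) + dOne α Y Z p * β p (X p) + dOne α Z X p * β p (Y p)

/-- The Nijenhuis torsion `N_A(X, Y) = A²[X, Y] + [A X, A Y] - A([A X, Y] + [X, A Y])`. -/
def nijenhuis (A : EndField E M) (X Y : VField E M) (p : M) : TangentSpace 𝓘(ℝ, E) p :=
  A p (A p (bracket X Y p)) + bracket (app A X) (app A Y) p
    - A p (bracket (app A X) Y p + bracket X (app A Y) p)

/-- The tensor `(X, Y) ↦ g(X, A Y)`: the fundamental 2-form of an almost Hermitian structure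
`(A, g)`, or of an almost contact metric structure `(A, ξ, η, g)`. -/
def fundamentalForm (A : EndField E M) (g : RMetric E M) : TwoField E M :=
  fun x u v => g.inner x u (A x v)

/-- The Lie derivative of the metric:
`(L_U g)(X, Y) = U(g(X, Y)) - g([U, X], Y) - g(X, [U, Y])`. -/
def lieMetric (U : VField E M) (g : RMetric E M) (X Y : VField E M) (p : M) : ℝ :=
  der U (fun x => g.inner x (X x) (Y x)) p
    - g.inner p (bracket U X p) (Y p) - g.inner p (X p) (bracket U Y p)

/-- The Lie derivative of an endomorphism field: `(L_U A)(X) = [U, A X] - A [U, X]`. -/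
def lieEnd (U : VField E M) (A : EndField E M) (X : VField E M) (p : M) :
    TangentSpace 𝓘(ℝ, E) p :=
  bracket U (app A X) p - A p (bracket U X p)

section Sharp

variable [FiniteDimensional ℝ E]

theorem exists_dual (g : RMetric E M) (x : M) (α : TangentSpace 𝓘(ℝ, E) x →L[ℝ] ℝ) :
    ∃ u : TangentSpace 𝓘(ℝ, E) x, ∀ v, g.inner x u v = α v := by
  have : FiniteDimensional ℝ (TangentSpace 𝓘(ℝ, E) x) := inferInstanceAs (FiniteDimensional ℝ E)
  let B : TangentSpace 𝓘(ℝ, E) x →ₗ[ℝ] Module.Dual ℝ (TangentSpace 𝓘(ℝ, E) x) :=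
    { toFun := fun u => (g.inner x u).toLinearMap
      map_add' := fun u v => by ext w; simp
      map_smul' := fun c u => by ext w; simp }
  have hB : Function.Injective B := by
    rw [injective_iff_map_eq_zero]
    intro u hu
    by_contra hne
    have h1 : g.inner x u u = 0 := LinearMap.congr_fun hu u
    exact absurd h1 (g.pos x u hne).ne'
  obtain ⟨u, hu⟩ := (LinearMap.injective_iff_surjective_of_finrank_eq_finrank
    (Subspace.dual_finrank_eq (K := ℝ) (V := TangentSpace 𝓘(ℝ, E) x)).symm).1 hB α.toLinearMap
  exact ⟨u, fun v => LinearMap.congr_fun hu v⟩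

/-- The metric dual vector field of a 1-form `α`: `g(α♯, v) = α(v)` for all `v`. -/
def sharp (g : RMetric E M) (α : CovField E M) : VField E M :=
  fun x => Classical.choose (exists_dual g x (α x))

theorem inner_sharp (g : RMetric E M) (α : CovField E M) (x : M)
    (v : TangentSpace 𝓘(ℝ, E) x) : g.inner x (sharp g α x) v = α x v :=
  Classical.choose_spec (exists_dual g x (α x)) v

end Sharp

/-- `(J, g)` is a Hermitian structure on `M`: an almost Hermitian structure with `N_J = 0`. -/
structure IsHermitian (J : EndField E M) (g : RMetric E M) : Prop where
  smooth : SmoothEndField J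
  sq : ∀ (p : M) (u : TangentSpace 𝓘(ℝ, E) p), J p (J p u) = -u
  compat : ∀ (p : M) (u v : TangentSpace 𝓘(ℝ, E) p), g.inner p (J p u) (J p v) = g.inner p u v
  integrable : ∀ (p : M) (X Y : VField E M), SmoothAt X p → SmoothAt Y p → nijenhuis J X Y p = 0

/-- The 1-form `η = -θ ∘ J`. -/
def antiForm (J : EndField E M) (θ : CovField E M) : CovField E M :=
  fun x => -(θ x).comp (J x)

/-- `(J, g, θ)` is a quasi-Vaisman structure on `M`: `(J, g)` is Hermitian, `θ` is a closed 1-form,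
its metric dual `U` is unitary and Killing, `L_U J = 0`, and `dΩ = dη ∧ θ`, where `Ω` is the
fundamental 2-form of `(J, g)` and `η = -θ ∘ J`. -/
structure IsQuasiVaisman [FiniteDimensional ℝ E]
    (J : EndField E M) (g : RMetric E M) (θ : CovField E M) : Prop where
  hermitian : IsHermitian J g
  smooth : SmoothCovField θ
  closed : ∀ (p : M) (X Y : VField E M), SmoothAt X p → SmoothAt Y p → dOne θ X Y p = 0
  unitary : ∀ p : M, g.inner p (sharp g θ p) (sharp g θ p) = 1
  killing : ∀ (p : M) (X Y : VField E M), SmoothAt X p → SmoothAt Y p →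
    lieMetric (sharp g θ) g X Y p = 0
  holomorphic : ∀ (p : M) (X : VField E M), SmoothAt X p → lieEnd (sharp g θ) J X p = 0
  d_fundamental : ∀ (p : M) (X Y Z : VField E M), SmoothAt X p → SmoothAt Y p → SmoothAt Z p →
    dTwo (fundamentalForm J g) X Y Z p = dOneWedge (antiForm J θ) θ X Y Z p

/-- `(φ, ξ, η, h)` is an almost contact metric structure. -/
structure IsAlmostContactMetric (φ : EndField E M) (ξ : VField E M) (η : CovField E M)
    (h : RMetric E M) : Prop where
  smooth_phi : SmoothEndField φ
  smooth_xi : SmoothVField ξ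
  smooth_eta : SmoothCovField η
  sq : ∀ (p : M) (u : TangentSpace 𝓘(ℝ, E) p), φ p (φ p u) = -u + η p u • ξ p
  eta_xi : ∀ p : M, η p (ξ p) = 1
  compat : ∀ (p : M) (u v : TangentSpace 𝓘(ℝ, E) p),
    h.inner p (φ p u) (φ p v) = h.inner p u v - η p u * η p v

/-- The almost contact metric structure `(φ, ξ, η, h)` is quasi-Sasakian: it is normal, that is
`N_φ + dη ⊗ ξ = 0`, and its fundamental 2-form `Φ(X, Y) = h(X, φ Y)` is closed. -/
structure IsQuasiSasakian (φ : EndField E M) (ξ : VField E M) (η : CovField E M)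
    (h : RMetric E M) : Prop extends IsAlmostContactMetric φ ξ η h where
  normal : ∀ (p : M) (X Y : VField E M), SmoothAt X p → SmoothAt Y p →
    nijenhuis φ X Y p + dOne η X Y p • ξ p = 0
  d_fundamental : ∀ (p : M) (X Y Z : VField E M), SmoothAt X p → SmoothAt Y p → SmoothAt Z p →
    dTwo (fundamentalForm φ h) X Y Z p = 0

/-- The distribution `ker θ` is involutive: the bracket of two (local) smooth vector fields
tangent to `ker θ` is again tangent to `ker θ`. -/
def KerIsInvolutive (θ : CovField E M) : Prop :=
  ∀ (p : M) (X Y : VField E M), SmoothAt X p → SmoothAt Y p →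
    (∀ᶠ x in 𝓝 p, θ x (X x) = 0) → (∀ᶠ x in 𝓝 p, θ x (Y x) = 0) → θ p (bracket X Y p) = 0

end Tensors

section Leaves

universe uE uM uF uL

variable {E : Type uE} [NormedAddCommGroup E] [NormedSpace ℝ E]
  {M : Type uM} [TopologicalSpace M] [ChartedSpace E M]
  {F : Type uF} [NormedAddCommGroup F] [NormedSpace ℝ F]
  {L : Type uL} [TopologicalSpace L] [ChartedSpace F L]

/-- The differential of `f` at `p`. -/
abbrev diff (f : L → M) (p : L) : TangentSpace 𝓘(ℝ, F) p →L[ℝ] TangentSpace 𝓘(ℝ, E) (f p) :=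
  mfderiv 𝓘(ℝ, F) 𝓘(ℝ, E) f p

/-- `ι : L → M` is a connected integral manifold of the distribution `ker θ`: an injective
immersion of a connected manifold whose tangent spaces are the spaces of the distribution. -/
structure IsIntegralManifold (F : Type uF) [NormedAddCommGroup F] [NormedSpace ℝ F]
    {L : Type uL} [TopologicalSpace L] [ChartedSpace F L] (θ : CovField E M) (ι : L → M) : Prop where
  connected : ConnectedSpace L
  immersion : Manifold.IsImmersion 𝓘(ℝ, F) 𝓘(ℝ, E) ∞ ι
  injective : Function.Injective ι
  tangent : ∀ (p : L) (w : TangentSpace 𝓘(ℝ, E) (ι p)), θ (ι p) w = 0 ↔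
    ∃ u : TangentSpace 𝓘(ℝ, F) p, diff ι p u = w

/-- `ι : L → M` is a leaf of the foliation `ker θ`: a maximal connected integral manifold. -/
structure IsLeaf (F : Type uF) [NormedAddCommGroup F] [NormedSpace ℝ F]
    {L : Type uL} [TopologicalSpace L] [ChartedSpace F L] (θ : CovField E M) (ι : L → M) : Prop
    extends IsIntegralManifold F θ ι where
  maximal : ∀ (N : Type uM) [TopologicalSpace N] [ChartedSpace F N] [IsManifold 𝓘(ℝ, F) ∞ N]
    (j : N → M), IsIntegralManifold F θ j → Set.range ι ⊆ Set.range j → Set.range j ⊆ Set.range ι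

variable [IsManifold 𝓘(ℝ, E) ∞ M] [IsManifold 𝓘(ℝ, F) ∞ L] [FiniteDimensional ℝ E]

/-- `(φ, ξ, η', h)` is the structure induced on `L` along `ι : L → M` by `(J, g, θ)`: writing
`η = -θ ∘ J` and `U`, `V` for the metric duals of `θ`, `η`, the field `ξ` is `V`, the tensors `η'`
and `h` are the restrictions of `η` and `g`, `φ ξ = 0`, and `φ = J` on the orthogonal complement
of `⟨U, V⟩`. -/
structure IsInduced (J : EndField E M) (g : RMetric E M) (θ : CovField E M) (ι : L → M)
    (φ : EndField F L) (ξ : VField F L) (η' : CovField F L) (h : RMetric F L) : Prop where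
  xi : ∀ p : L, diff ι p (ξ p) = sharp g (antiForm J θ) (ι p)
  eta : ∀ (p : L) (u : TangentSpace 𝓘(ℝ, F) p), η' p u = antiForm J θ (ι p) (diff ι p u)
  metric : ∀ (p : L) (u v : TangentSpace 𝓘(ℝ, F) p),
    h.inner p u v = g.inner (ι p) (diff ι p u) (diff ι p v)
  phi_xi : ∀ p : L, φ p (ξ p) = 0
  phi : ∀ (p : L) (u : TangentSpace 𝓘(ℝ, F) p),
    g.inner (ι p) (diff ι p u) (sharp g θ (ι p)) = 0 →
    g.inner (ι p) (diff ι p u) (sharp g (antiForm J θ) (ι p)) = 0 →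
    diff ι p (φ p u) = J (ι p) (diff ι p u)

end Leaves

end LeafGeometry

end

open LeafGeometry

/-!
Write `U` for the metric dual of `θ`, `η = -θ ∘ J`, and `V = J U` for the metric dual of `η`.

Involutivity of `ker θ` is immediate from `dθ = 0`. The tensor `φ` on a leaf `ι : L → M` is the
restriction of the tensor `J + η ⊗ U` of `M` (`phiField`, `IsInduced.diff_phi`), which maps `ker θ`
to itself; the algebraic identities of an almost contact metric structure follow pointwise.

Smoothness and the differential identities are transferred between `L` and `M` by related vector
fields. A vector field on `L` extends locally to a related one on `M` (`exists_related_extension`), a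
field on `L` related to a smooth field on `M` is smooth (`smoothAt_of_related`), and related fields
have related brackets (`bracket_of_related`). Since tensor fields are smooth as soon as they map
smooth fields to smooth fields (`contMDiffAt_hom_of_apply`), the induced tensors are smooth.

Normality then reduces to an identity on `M`: for `X`, `Y` tangent to `ker θ`, the torsion of
`J + η ⊗ U` satisfies `N(X, Y) + dη(X, Y) V = 0` (`IsQuasiVaisman.nijenhuis_phiField`). It uses
`N_J = 0`, `dθ = 0`, `[U, J X] = J [U, X]` and `L_U η = 0`. Finally the fundamental form `Φ` of
the leaf is `ι^* Ω`, because `U` is orthogonal to the leaf; hence `dΦ = ι^* (dη ∧ θ) = 0`.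
-/

namespace LeafGeometry

/-! ### Lie brackets of related vector fields -/

section Related

/-- In normed spaces, `f`-related vector fields have `f`-related Lie brackets: differentiate the
relation once more and use the symmetry of the second derivative of `f`. -/
theorem lieBracket_of_related {E F : Type*} [NormedAddCommGroup E] [NormedSpace ℝ E]
    [NormedAddCommGroup F] [NormedSpace ℝ F] {f : F → E} {V W : F → F} {V' W' : E → E} {x : F}
    (hf : ContDiffAt ℝ 2 f x)
    (hV : DifferentiableAt ℝ V x) (hW : DifferentiableAt ℝ W x)
    (hV' : DifferentiableAt ℝ V' (f x)) (hW' : DifferentiableAt ℝ W' (f x))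
    (hVV' : ∀ᶠ y in 𝓝 x, V' (f y) = fderiv ℝ f y (V y))
    (hWW' : ∀ᶠ y in 𝓝 x, W' (f y) = fderiv ℝ f y (W y)) :
    lieBracket ℝ V' W' (f x) = fderiv ℝ f x (lieBracket ℝ V W x) := by
  have hd : DifferentiableAt ℝ (fderiv ℝ f) x :=
    (hf.fderiv_right (m := 1) (by norm_num)).differentiableAt (by norm_num)
  have hfx : DifferentiableAt ℝ f x := hf.differentiableAt (by norm_num)
  have key : ∀ {X : F → F} {X' : E → E}, DifferentiableAt ℝ X x → DifferentiableAt ℝ X' (f x) →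
      (∀ᶠ y in 𝓝 x, X' (f y) = fderiv ℝ f y (X y)) → ∀ v,
      fderiv ℝ X' (f x) (fderiv ℝ f x v) =
        fderiv ℝ f x (fderiv ℝ X x v) + fderiv ℝ (fderiv ℝ f) x v (X x) := by
    intro X X' hX hX' h v
    have h1 : fderiv ℝ (X' ∘ f) x = fderiv ℝ (fun y => fderiv ℝ f y (X y)) x :=
      Filter.EventuallyEq.fderiv_eq h
    rw [fderiv_comp x hX' hfx, fderiv_clm_apply hd hX] at h1
    simpa using congrArg (fun T => T v) h1
  have hs : IsSymmSndFDerivAt ℝ f x := hf.isSymmSndFDerivAt (by simp)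
  rw [lieBracket, lieBracket, hVV'.self_of_nhds, hWW'.self_of_nhds, key hV hV' hVV',
    key hW hW' hWW', hs.eq (W x) (V x), map_sub]
  abel

variable {E : Type*} [NormedAddCommGroup E] [NormedSpace ℝ E] [CompleteSpace E]
  {M : Type*} [TopologicalSpace M] [ChartedSpace E M] [IsManifold 𝓘(ℝ, E) ∞ M]
  {F : Type*} [NormedAddCommGroup F] [NormedSpace ℝ F] [CompleteSpace F]
  {L : Type*} [TopologicalSpace L] [ChartedSpace F L] [IsManifold 𝓘(ℝ, F) ∞ L]

omit [IsManifold 𝓘(ℝ, E) ∞ M] [CompleteSpace E] in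
/-- The expression of the vector field `V` in the preferred chart at `x`, a vector field on the
model space. -/
noncomputable def coordField (x : M) (V : VField E M) : E → E :=
  mpullbackWithin 𝓘(ℝ, E) 𝓘(ℝ, E) (extChartAt 𝓘(ℝ, E) x).symm V (Set.range 𝓘(ℝ, E))

omit [CompleteSpace E] in
theorem coordField_extChartAt (V : VField E M) {x z : M}
    (hz : z ∈ (extChartAt 𝓘(ℝ, E) x).source) :
    coordField x V (extChartAt 𝓘(ℝ, E) x z) =
      mfderiv 𝓘(ℝ, E) 𝓘(ℝ, E) (extChartAt 𝓘(ℝ, E) x) z (V z) := by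
  have : IsManifold 𝓘(ℝ, E) 1 M := .of_le (n := ∞) (by simp)
  have A : (extChartAt 𝓘(ℝ, E) x).symm (extChartAt 𝓘(ℝ, E) x z) = z :=
    (extChartAt 𝓘(ℝ, E) x).left_inv hz
  have hinv := isInvertible_mfderiv_extChartAt (I := 𝓘(ℝ, E)) hz
  have h2 : mpullback 𝓘(ℝ, E) 𝓘(ℝ, E) (extChartAt 𝓘(ℝ, E) x)
      (mpullbackWithin 𝓘(ℝ, E) 𝓘(ℝ, E) (extChartAt 𝓘(ℝ, E) x).symm V (Set.range 𝓘(ℝ, E))) z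
        = V z := by
    rw [mpullback_apply, mpullbackWithin_apply,
      ← (isInvertible_mfderiv_extChartAt hz).inverse_comp_apply_of_right,
      mfderivWithin_extChartAt_symm_comp_mfderiv_extChartAt' hz, A]
    simp only [ContinuousLinearMap.inverse_id, ContinuousLinearMap.coe_id', id_eq]
  rw [mpullback_apply, hinv.inverse_apply_eq] at h2
  exact h2

omit [CompleteSpace E] in
theorem mfderiv_extChartAt_bracket (V W : VField E M) (x : M) :
    mfderiv 𝓘(ℝ, E) 𝓘(ℝ, E) (extChartAt 𝓘(ℝ, E) x) x (bracket V W x) =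
      lieBracket ℝ (coordField x V) (coordField x W) (extChartAt 𝓘(ℝ, E) x x) := by
  have : IsManifold 𝓘(ℝ, E) 1 M := .of_le (n := ∞) (by simp)
  have i := isInvertible_mfderiv_extChartAt (I := 𝓘(ℝ, E)) (mem_extChartAt_source x)
  have hs : (extChartAt 𝓘(ℝ, E) x).symm ⁻¹' Set.univ ∩ Set.range 𝓘(ℝ, E) = Set.univ := by simp
  have c := mlieBracketWithin_apply (I := 𝓘(ℝ, E)) (V := V) (W := W) (s := Set.univ) (x₀ := x)
  rw [mlieBracketWithin_univ, hs] at c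
  refine (i.inverse_apply_eq.1 c.symm).symm.trans ?_
  exact congrFun (lieBracketWithin_univ (𝕜 := ℝ) (V := coordField x V) (W := coordField x W)) _

theorem SmoothAt.differentiableAt_coordField {V : VField E M} {x : M} (hV : SmoothAt V x) :
    DifferentiableAt ℝ (coordField x V) (extChartAt 𝓘(ℝ, E) x x) := by
  have : IsManifold 𝓘(ℝ, E) 1 M := .of_le (n := ∞) (by simp)
  have : IsManifold 𝓘(ℝ, E) 2 M := .of_le (n := ∞) (by norm_cast)
  have h := ((ContMDiffAt.mdifferentiableAt hV (by simp)).mdifferentiableWithinAt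
    (s := Set.univ)).differentiableWithinAt_mpullbackWithin_vectorField
  have hs : (extChartAt 𝓘(ℝ, E) x).symm ⁻¹' Set.univ ∩ Set.range 𝓘(ℝ, E) = Set.univ := by simp
  rw [hs] at h
  exact differentiableWithinAt_univ.1 h

/-- If `V'`, `W'` are `f`-related to `V`, `W` near `x`, then `[V', W']` is `f`-related to `[V, W]`
at `x`. No invertibility of the differential of `f` is needed: both sides are read in charts. -/
theorem bracket_of_related {f : L → M} {V W : VField F L} {V' W' : VField E M} {x : L}
    (hf : ContMDiff 𝓘(ℝ, F) 𝓘(ℝ, E) ∞ f)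
    (hV : SmoothAt V x) (hW : SmoothAt W x) (hV' : SmoothAt V' (f x)) (hW' : SmoothAt W' (f x))
    (hVV' : ∀ᶠ y in 𝓝 x, V' (f y) = diff f y (V y))
    (hWW' : ∀ᶠ y in 𝓝 x, W' (f y) = diff f y (W y)) :
    bracket V' W' (f x) = diff f x (bracket V W x) := by
  have : IsManifold 𝓘(ℝ, E) 1 M := .of_le (n := ∞) (by simp)
  have : IsManifold 𝓘(ℝ, F) 1 L := .of_le (n := ∞) (by simp)
  set φ := extChartAt 𝓘(ℝ, F) x
  set ψ := extChartAt 𝓘(ℝ, E) (f x)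
  -- `f` read in the charts `φ` and `ψ`
  set f' : F → E := ψ ∘ f ∘ φ.symm
  have hxφ : φ.symm (φ x) = x := extChartAt_to_inv x
  have hfx : f' (φ x) = ψ (f x) := by simp [f', hxφ]
  have hsrc : ∀ᶠ y in 𝓝 (φ x), y ∈ φ.target ∧ φ.symm y ∈ φ.source ∧ f (φ.symm y) ∈ ψ.source := by
    have hc : ContinuousAt φ.symm (φ x) := continuousAt_extChartAt_symm x
    have h1 : φ.target ∈ 𝓝 (φ x) := extChartAt_target_mem_nhds x
    have h2 : ∀ᶠ z in 𝓝 x, f z ∈ ψ.source :=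
      hf.continuous.continuousAt (extChartAt_source_mem_nhds (I := 𝓘(ℝ, E)) (f x))
    have h3 : ∀ᶠ y in 𝓝 (φ x), f (φ.symm y) ∈ ψ.source := hc.eventually (by rwa [hxφ])
    filter_upwards [h1, h3] with y hy hy' using ⟨hy, φ.map_target hy, hy'⟩
  have df : ∀ z, MDifferentiableAt 𝓘(ℝ, F) 𝓘(ℝ, E) f z := hf.mdifferentiable (by simp)
  -- the chain rule for `f' ∘ φ = ψ ∘ f`
  have chain : ∀ z ∈ φ.source, f z ∈ ψ.source → ∀ v : TangentSpace 𝓘(ℝ, F) z,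
      mfderiv 𝓘(ℝ, E) 𝓘(ℝ, E) ψ (f z) (diff f z v) =
        fderiv ℝ f' (φ z) (mfderiv 𝓘(ℝ, F) 𝓘(ℝ, F) φ z v) := by
    intro z hz hy2 v
    have h4 : mfderiv 𝓘(ℝ, F) 𝓘(ℝ, E) (f' ∘ φ) z = mfderiv 𝓘(ℝ, F) 𝓘(ℝ, E) (ψ ∘ f) z := by
      apply Filter.EventuallyEq.mfderiv_eq
      filter_upwards [extChartAt_source_mem_nhds' (I := 𝓘(ℝ, F)) hz] with w hw
      simp only [f', Function.comp_apply]
      rw [φ.left_inv hw]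
    have dφ : MDifferentiableAt 𝓘(ℝ, F) 𝓘(ℝ, F) φ z :=
      mdifferentiableAt_extChartAt (by simpa [φ] using hz)
    have dψ : MDifferentiableAt 𝓘(ℝ, E) 𝓘(ℝ, E) ψ (f z) :=
      mdifferentiableAt_extChartAt (by simpa [ψ] using hy2)
    have df' : MDifferentiableAt 𝓘(ℝ, F) 𝓘(ℝ, E) f' (φ z) := by
      have a1 : MDifferentiableAt 𝓘(ℝ, F) 𝓘(ℝ, F) φ.symm (φ z) :=
        ((contMDiffOn_extChartAt_symm (I := 𝓘(ℝ, F)) (n := ∞) x).contMDiffAt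
          ((isOpen_extChartAt_target x).mem_nhds (φ.map_source hz))).mdifferentiableAt (by simp)
      have a2 : MDifferentiableAt 𝓘(ℝ, F) 𝓘(ℝ, E) f (φ.symm (φ z)) := df _
      have a3 : MDifferentiableAt 𝓘(ℝ, E) 𝓘(ℝ, E) ψ ((f ∘ φ.symm) (φ z)) := by
        simpa [φ.left_inv hz] using dψ
      exact a3.comp _ (a2.comp _ a1)
    rw [mfderiv_comp z df' dφ, mfderiv_comp z dψ (df z)] at h4
    have h5 := congrArg (fun T => T v) h4
    simp only [ContinuousLinearMap.comp_apply] at h5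
    rw [← mfderiv_eq_fderiv]
    exact h5.symm
  have key : ∀ {X : VField F L} {X' : VField E M}, (∀ᶠ y in 𝓝 x, X' (f y) = diff f y (X y)) →
      ∀ᶠ y in 𝓝 (φ x),
        coordField (f x) X' (f' y) =
        fderiv ℝ f' y (coordField x X y) := by
    intro X X' h
    have hc : ContinuousAt φ.symm (φ x) := continuousAt_extChartAt_symm x
    have h3 : ∀ᶠ y in 𝓝 (φ x), X' (f (φ.symm y)) = diff f (φ.symm y) (X (φ.symm y)) :=
      hc.eventually (p := fun z => X' (f z) = diff f z (X z)) (by rwa [hxφ])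
    filter_upwards [hsrc, h3] with y ⟨hy, hy1, hy2⟩ hX
    obtain ⟨z, hz, rfl⟩ : ∃ z, z ∈ φ.source ∧ y = φ z := ⟨_, hy1, (φ.right_inv hy).symm⟩
    rw [φ.left_inv hz] at hy2 hX
    have e1 : f' (φ z) = ψ (f z) := by simp [f', φ.left_inv hz]
    rw [e1, coordField_extChartAt X' hy2, coordField_extChartAt X hz, hX, chain z hz hy2]
  have hf'2 : ContDiffAt ℝ 2 f' (φ x) := by
    have a1 : ContMDiffAt 𝓘(ℝ, F) 𝓘(ℝ, F) ∞ φ.symm (φ x) :=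
      (contMDiffOn_extChartAt_symm (I := 𝓘(ℝ, F)) (n := ∞) x).contMDiffAt
        (extChartAt_target_mem_nhds x)
    have a3 : ContMDiffAt 𝓘(ℝ, E) 𝓘(ℝ, E) ∞ ψ (f (φ.symm (φ x))) := by
      rw [hxφ]; exact contMDiffAt_extChartAt
    have := (a3.comp (φ x) ((hf _).comp (φ x) a1)).contDiffAt
    exact this.of_le (by norm_cast)
  have main := lieBracket_of_related hf'2 hV.differentiableAt_coordField
    hW.differentiableAt_coordField (hfx ▸ hV'.differentiableAt_coordField)
    (hfx ▸ hW'.differentiableAt_coordField) (key hVV') (key hWW')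
  rw [hfx] at main
  have i1 := isInvertible_mfderiv_extChartAt (I := 𝓘(ℝ, E)) (mem_extChartAt_source (f x))
  apply i1.injective
  rw [mfderiv_extChartAt_bracket, chain x (mem_extChartAt_source x) (mem_extChartAt_source _),
    mfderiv_extChartAt_bracket, main]

end Related

/-! ### Immersions: retractions, extension and restriction of vector fields -/

section Immersion

variable {E : Type*} [NormedAddCommGroup E] [NormedSpace ℝ E]
  {M : Type*} [TopologicalSpace M] [ChartedSpace E M]
  {F : Type*} [NormedAddCommGroup F] [NormedSpace ℝ F]
  {L : Type*} [TopologicalSpace L] [ChartedSpace F L]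
  {ι : L → M}

/-- An immersion has a smooth left inverse locally: in the charts where it is `u ↦ (u, 0)`, the
projection `(u, c) ↦ u`. -/
theorem exists_local_retraction (hι : Manifold.IsImmersion 𝓘(ℝ, F) 𝓘(ℝ, E) ∞ ι) (p : L) :
    ∃ (U : Set M) (r : M → L), IsOpen U ∧ ι p ∈ U ∧ ContMDiffOn 𝓘(ℝ, E) 𝓘(ℝ, F) ∞ r U ∧
      ∀ᶠ q in 𝓝 p, r (ι q) = q := by
  have h := hι.isImmersionAt p
  set φ := h.domChart
  set ψ := h.codChart
  set l : E → F := fun y => (h.equiv.symm y).1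
  have hlc : ContDiff ℝ ∞ l := contDiff_fst.comp h.equiv.symm.contDiff
  have hwr : ∀ q ∈ φ.source, l (ψ (ι q)) = φ q := by
    intro q hq
    have hq' : φ q ∈ (h.domChart.extend 𝓘(ℝ, F)).target := by simpa [φ] using φ.map_source hq
    have := h.writtenInCharts hq'
    simp only [OpenPartialHomeomorph.extend, Function.comp_apply, mfld_simps] at this
    rw [φ.left_inv hq] at this
    simp [l, ψ, this]
  refine ⟨ψ.source ∩ ψ ⁻¹' (l ⁻¹' φ.target), φ.symm ∘ l ∘ ψ, ?_, ?_, ?_, ?_⟩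
  · exact ψ.continuousOn.isOpen_inter_preimage ψ.open_source
      (φ.open_target.preimage hlc.continuous)
  · refine ⟨h.mem_codChart_source, ?_⟩
    simp only [Set.mem_preimage]
    rw [hwr p h.mem_domChart_source]
    exact φ.map_source h.mem_domChart_source
  · have h1 : ContMDiffOn 𝓘(ℝ, E) 𝓘(ℝ, E) ∞ ψ ψ.source :=
      contMDiffOn_of_mem_maximalAtlas h.codChart_mem_maximalAtlas
    have h2 : ContMDiffOn 𝓘(ℝ, F) 𝓘(ℝ, F) ∞ φ.symm φ.target :=
      contMDiffOn_symm_of_mem_maximalAtlas h.domChart_mem_maximalAtlas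
    exact h2.comp (hlc.contMDiff.comp_contMDiffOn (h1.mono Set.inter_subset_left))
      (fun y hy => hy.2)
  · filter_upwards [φ.open_source.mem_nhds h.mem_domChart_source] with q hq
    simp only [Function.comp_apply]
    rw [hwr q hq, φ.left_inv hq]

theorem tangentMap_eq_self {f : L → L} {q : L} (hf : ∀ᶠ y in 𝓝 q, f y = y)
    (w : TangentSpace 𝓘(ℝ, F) q) :
    tangentMap 𝓘(ℝ, F) 𝓘(ℝ, F) f ⟨q, w⟩ = ⟨q, w⟩ := by
  have h : mfderiv 𝓘(ℝ, F) 𝓘(ℝ, F) f q = ContinuousLinearMap.id ℝ F :=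
    (Filter.EventuallyEq.mfderiv_eq (f₁ := f) (f := id) hf).trans mfderiv_id
  have h' : (mfderiv 𝓘(ℝ, F) 𝓘(ℝ, F) f q w : F) = w := congrArg (fun T : F →L[ℝ] F => T w) h
  exact congrArg₂ (fun (a : L) (b : F) => (⟨a, b⟩ : TangentBundle 𝓘(ℝ, F) L))
    hf.self_of_nhds h'

theorem eventually_tangentMap_retraction [IsManifold 𝓘(ℝ, E) ∞ M] [IsManifold 𝓘(ℝ, F) ∞ L]
    (hι : ContMDiff 𝓘(ℝ, F) 𝓘(ℝ, E) ∞ ι) {p : L} {U : Set M} {r : M → L} (hU : IsOpen U)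
    (hp : ι p ∈ U) (hrs : ContMDiffOn 𝓘(ℝ, E) 𝓘(ℝ, F) ∞ r U) (hr : ∀ᶠ q in 𝓝 p, r (ι q) = q) :
    ∀ᶠ q in 𝓝 p, ∀ w : TangentSpace 𝓘(ℝ, F) q,
      tangentMap 𝓘(ℝ, E) 𝓘(ℝ, F) r ⟨ι q, diff (E := E) (F := F) ι q w⟩ = ⟨q, w⟩ := by
  filter_upwards [hr.eventually_nhds, hι.continuous.continuousAt (hU.mem_nhds hp)] with q hq hqU w
  rw [← tangentMap_eq_self (f := r ∘ ι) hq w,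
    tangentMap_comp_at (I := 𝓘(ℝ, F)) (I' := 𝓘(ℝ, E)) (I'' := 𝓘(ℝ, F)) (f := ι) (g := r)]
  · rfl
  · exact ((hrs _ hqU).contMDiffAt (hU.mem_nhds hqU)).mdifferentiableAt (by simp)
  · exact hι.mdifferentiable (by simp) q

variable [IsManifold 𝓘(ℝ, E) ∞ M] [IsManifold 𝓘(ℝ, F) ∞ L]

theorem diff_injective (hι : Manifold.IsImmersion 𝓘(ℝ, F) 𝓘(ℝ, E) ∞ ι) (p : L) :
    Function.Injective (diff (E := E) (F := F) ι p) := by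
  obtain ⟨U, r, hU, hp, hrs, hr⟩ := exists_local_retraction hι p
  have h := (eventually_tangentMap_retraction hι.contMDiff hU hp hrs hr).self_of_nhds
  intro v w hvw
  have := h v
  rw [hvw, h w] at this
  simpa using this.symm

/-- A vector field on the source of an immersion extends, near a point, to a related vector field
on the target: in a local trivialization of the tangent bundle of the target, it is made constant
along the fibres of a local retraction. -/
theorem exists_related_extension (hι : Manifold.IsImmersion 𝓘(ℝ, F) 𝓘(ℝ, E) ∞ ι) {p : L}
    {X : VField F L} (hX : SmoothAt X p) :
    ∃ X' : VField E M, SmoothAt X' (ι p) ∧ ∀ᶠ q in 𝓝 p, X' (ι q) = diff ι q (X q) := by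
  have i1 : IsManifold 𝓘(ℝ, E) 1 M := .of_le (n := ∞) (by simp)
  have i2 : IsManifold 𝓘(ℝ, F) 1 L := .of_le (n := ∞) (by simp)
  obtain ⟨U, r, hU, hp, hrs, hr⟩ := exists_local_retraction hι p
  set e := trivializationAt E (TangentSpace 𝓘(ℝ, E) : M → Type _) (ι p)
  set c : L → E := fun q => (e (tangentMap 𝓘(ℝ, F) 𝓘(ℝ, E) ι ⟨q, X q⟩)).2
  have hιs : ContMDiff 𝓘(ℝ, F) 𝓘(ℝ, E) ∞ ι := hι.contMDiff
  have hbase : e.baseSet ∈ 𝓝 (ι p) :=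
    e.open_baseSet.mem_nhds (FiberBundle.mem_baseSet_trivializationAt' (ι p))
  have hcs : ContMDiffAt 𝓘(ℝ, F) 𝓘(ℝ, E) ∞ c p := by
    have h1 : ContMDiffAt 𝓘(ℝ, F) 𝓘(ℝ, E).tangent ∞
        (fun q => tangentMap 𝓘(ℝ, F) 𝓘(ℝ, E) ι ⟨q, X q⟩) p :=
      (hιs.contMDiff_tangentMap (m := ∞) (by simp)).contMDiffAt.comp p hX
    exact (contMDiffAt_totalSpace.1 h1).2
  refine ⟨fun y => e.symm y (c (r y)), ?_, ?_⟩
  · rw [SmoothAt]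
    refine (Bundle.contMDiffAt_section (ι p)).2 ?_
    have h1 : ContMDiffAt 𝓘(ℝ, E) 𝓘(ℝ, E) ∞ (fun y => c (r y)) (ι p) := by
      have h2 := hrs.contMDiffAt (hU.mem_nhds hp)
      refine ContMDiffAt.comp (ι p) (g := c) ?_ h2
      rwa [hr.self_of_nhds]
    refine h1.congr_of_eventuallyEq ?_
    filter_upwards [hbase] with y hy
    have := congrArg Prod.snd (e.apply_mk_symm hy (c (r y)))
    exact this
  · filter_upwards [hr, hιs.continuous.continuousAt hbase] with q hq hqb
    rw [hq]
    exact e.symm_apply_apply_mk hqb (diff ι q (X q))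

/-- If a smooth vector field on the target of an immersion is tangent to it, the vector field it
induces on the source is smooth: it is recovered through the differential of a local retraction. -/
theorem smoothAt_of_related (hι : Manifold.IsImmersion 𝓘(ℝ, F) 𝓘(ℝ, E) ∞ ι) {p : L}
    {W : VField F L} {Z : VField E M} (hZ : SmoothAt Z (ι p))
    (h : ∀ᶠ q in 𝓝 p, Z (ι q) = diff ι q (W q)) : SmoothAt W p := by
  have i1 : IsManifold 𝓘(ℝ, E) 1 M := .of_le (n := ∞) (by simp)
  have i2 : IsManifold 𝓘(ℝ, F) 1 L := .of_le (n := ∞) (by simp)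
  obtain ⟨U, r, hU, hp, hrs, hr⟩ := exists_local_retraction hι p
  have hιs : ContMDiff 𝓘(ℝ, F) 𝓘(ℝ, E) ∞ ι := hι.contMDiff
  have hrp := hrs.contMDiffAt (hU.mem_nhds hp)
  have h1 : ContMDiffAt 𝓘(ℝ, E) 𝓘(ℝ, F).tangent ∞
      (fun y => (⟨r y, mfderiv 𝓘(ℝ, E) 𝓘(ℝ, F) r y (Z y)⟩ : TangentBundle 𝓘(ℝ, F) L)) (ι p) := by
    refine ContMDiffAt.clm_apply_of_inCoordinates (b₁ := id) (b₂ := r)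
      (ϕ := fun y => mfderiv 𝓘(ℝ, E) 𝓘(ℝ, F) r y) (v := Z) ?_ hZ hrp
    exact ContMDiffAt.mfderiv_const hrp (m := ∞) (by simp)
  refine (h1.comp p (hιs p)).congr_of_eventuallyEq ?_
  filter_upwards [h, eventually_tangentMap_retraction hιs hU hp hrs hr] with q hq hq'
  rw [← hq' (W q), ← hq]
  rfl

end Immersion

/-! ### Smoothness of tensor fields, tested on smooth vector fields -/

section Sections

variable {E : Type*} [NormedAddCommGroup E] [NormedSpace ℝ E] [FiniteDimensional ℝ E]
  {M : Type*} [TopologicalSpace M] [ChartedSpace E M]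

theorem contMDiffAt_clm_of_apply {G : Type*} [NormedAddCommGroup G] [NormedSpace ℝ G]
    {A : M → E →L[ℝ] G} {p : M}
    (h : ∀ v, ContMDiffAt 𝓘(ℝ, E) 𝓘(ℝ, G) ∞ (fun x => A x v) p) :
    ContMDiffAt 𝓘(ℝ, E) 𝓘(ℝ, E →L[ℝ] G) ∞ A p := by
  let b := Module.finBasis ℝ E
  have hA : A = fun x => ∑ i, (ContinuousLinearMap.smulRightL ℝ E G
      (LinearMap.toContinuousLinearMap (b.coord i))) (A x (b i)) := by
    funext x
    ext v
    conv_lhs => rw [← b.sum_repr v]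
    simp [-Module.Basis.sum_repr]
  rw [hA]
  refine contMDiffAt_finsetSum fun i _ => ?_
  exact (ContinuousLinearMap.contMDiff _).contMDiffAt.comp p (h (b i))

variable [IsManifold 𝓘(ℝ, E) ∞ M]

/-- A section of `Hom(TM, B)` is smooth at `p` if it maps vector fields smooth at `p` to sections
of `B` smooth at `p`. The test fields are those with constant coordinates in a trivialization. -/
theorem contMDiffAt_hom_of_apply {G : Type*} [NormedAddCommGroup G] [NormedSpace ℝ G]
    {B : M → Type*} [TopologicalSpace (TotalSpace G B)] [∀ x, AddCommGroup (B x)]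
    [∀ x, Module ℝ (B x)] [∀ x, TopologicalSpace (B x)]
    [∀ x, IsTopologicalAddGroup (B x)] [∀ x, ContinuousSMul ℝ (B x)]
    [FiberBundle G B] [VectorBundle ℝ G B]
    {A : Π x : M, TangentSpace 𝓘(ℝ, E) x →L[ℝ] B x} {p : M}
    (h : ∀ X : VField E M, SmoothAt X p → ContMDiffAt 𝓘(ℝ, E) (𝓘(ℝ, E).prod 𝓘(ℝ, G)) ∞
      (fun x => TotalSpace.mk' G x (A x (X x))) p) :
    ContMDiffAt 𝓘(ℝ, E) (𝓘(ℝ, E).prod 𝓘(ℝ, E →L[ℝ] G)) ∞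
      (fun x => TotalSpace.mk' (E →L[ℝ] G)
        (E := fun x : M => TangentSpace 𝓘(ℝ, E) x →L[ℝ] B x) x (A x)) p := by
  have i1 : IsManifold 𝓘(ℝ, E) 1 M := .of_le (n := ∞) (by simp)
  rw [contMDiffAt_hom_bundle]
  refine ⟨contMDiffAt_id, contMDiffAt_clm_of_apply fun v => ?_⟩
  set e := trivializationAt E (TangentSpace 𝓘(ℝ, E) : M → Type _) p
  set e' := trivializationAt G B p
  have hbase : e.baseSet ∈ 𝓝 p :=
    e.open_baseSet.mem_nhds (FiberBundle.mem_baseSet_trivializationAt' p)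
  have hbase' : e'.baseSet ∈ 𝓝 p :=
    e'.open_baseSet.mem_nhds (FiberBundle.mem_baseSet_trivializationAt' p)
  have hX : SmoothAt (fun x => e.symm x v : VField E M) p := by
    refine (Bundle.contMDiffAt_section p).2 ?_
    refine (contMDiffAt_const (c := v)).congr_of_eventuallyEq ?_
    filter_upwards [hbase] with y hy
    exact congrArg Prod.snd (e.apply_mk_symm hy v)
  have h1 := (Bundle.contMDiffAt_section p).1 (h _ hX)
  refine h1.congr_of_eventuallyEq ?_
  filter_upwards [hbase, hbase'] with x hx hx'
  rw [ContinuousLinearMap.inCoordinates_eq hx hx']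
  simp [e', e]

end Sections

section Smoothness

variable {E : Type*} [NormedAddCommGroup E] [NormedSpace ℝ E]
  {M : Type*} [TopologicalSpace M] [ChartedSpace E M]

theorem contMDiffAt_trivial_section_iff {f : M → ℝ} {p : M} :
    ContMDiffAt 𝓘(ℝ, E) (𝓘(ℝ, E).prod 𝓘(ℝ, ℝ)) ∞
      (fun x => TotalSpace.mk' ℝ (E := Bundle.Trivial M ℝ) x (f x)) p ↔
      ContMDiffAt 𝓘(ℝ, E) 𝓘(ℝ, ℝ) ∞ f p := by
  rw [Bundle.contMDiffAt_section]
  rfl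

variable [IsManifold 𝓘(ℝ, E) ∞ M]

theorem SmoothAt.app {A : EndField E M} (hA : SmoothEndField A) {X : VField E M} {p : M}
    (hX : SmoothAt X p) : SmoothAt (app A X) p :=
  ContMDiffAt.clm_bundle_apply (hA p) hX

theorem SmoothAt.covField_apply {α : CovField E M} (hα : SmoothCovField α) {X : VField E M} {p : M}
    (hX : SmoothAt X p) : ContMDiffAt 𝓘(ℝ, E) 𝓘(ℝ, ℝ) ∞ (fun x => α x (X x)) p :=
  contMDiffAt_trivial_section_iff.1 (ContMDiffAt.clm_bundle_apply (hα p) hX)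

theorem SmoothAt.inner (g : RMetric E M) {X Y : VField E M} {p : M}
    (hX : SmoothAt X p) (hY : SmoothAt Y p) :
    ContMDiffAt 𝓘(ℝ, E) 𝓘(ℝ, ℝ) ∞ (fun x => g.inner x (X x) (Y x)) p :=
  contMDiffAt_trivial_section_iff.1 (ContMDiffAt.clm_bundle_apply₂ (g.contMDiff p) hX hY)

theorem SmoothAt.add {X Y : VField E M} {p : M} (hX : SmoothAt X p) (hY : SmoothAt Y p) :
    SmoothAt (X + Y) p :=
  ContMDiffAt.add_section hX hY

theorem SmoothAt.smul {f : M → ℝ} {X : VField E M} {p : M}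
    (hf : ContMDiffAt 𝓘(ℝ, E) 𝓘(ℝ, ℝ) ∞ f p) (hX : SmoothAt X p) :
    SmoothAt (f • X) p :=
  ContMDiffAt.smul_section hf hX

variable [FiniteDimensional ℝ E]

theorem smoothEndField_of_app {A : EndField E M}
    (h : ∀ (p : M) (X : VField E M), SmoothAt X p → SmoothAt (app A X) p) : SmoothEndField A :=
  fun p => contMDiffAt_hom_of_apply (h p)

theorem smoothCovField_of_apply {α : CovField E M}
    (h : ∀ (p : M) (X : VField E M), SmoothAt X p →
      ContMDiffAt 𝓘(ℝ, E) 𝓘(ℝ, ℝ) ∞ (fun x => α x (X x)) p) : SmoothCovField α :=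
  fun p => contMDiffAt_hom_of_apply (fun X hX => contMDiffAt_trivial_section_iff.2 (h p X hX))

/-- The metric dual of a smooth 1-form is smooth: in a trivialization it is obtained by inverting
the Gram matrix, here the invertible map `G x : E →L[ℝ] E →L[ℝ] ℝ`. -/
theorem smoothVField_sharp (g : RMetric E M) {α : CovField E M} (hα : SmoothCovField α) :
    SmoothVField (sharp g α) := by
  intro p
  set e := trivializationAt E (TangentSpace 𝓘(ℝ, E) : M → Type _) p
  have hbase : e.baseSet ∈ 𝓝 p :=
    e.open_baseSet.mem_nhds (FiberBundle.mem_baseSet_trivializationAt' p)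
  have hconst : ∀ v : E, SmoothAt (fun x => e.symmL ℝ x v : VField E M) p := by
    intro v
    refine (Bundle.contMDiffAt_section p).2 ?_
    refine (contMDiffAt_const (c := v)).congr_of_eventuallyEq ?_
    filter_upwards [hbase] with y hy
    have := congrArg Prod.snd (e.apply_mk_symm hy v)
    rw [e.symmL_apply hy]
    exact this
  -- the Gram matrix of `g` and the components of `α`, in the trivialization `e`
  let G : M → E →L[ℝ] E →L[ℝ] ℝ := fun x =>
    ContinuousLinearMap.bilinearComp (E := E) (F := E) (g.inner x) (e.symmL ℝ x) (e.symmL ℝ x)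
  let a : M → E →L[ℝ] ℝ := fun x => (α x).comp (e.symmL ℝ x)
  have hG : ContMDiffAt 𝓘(ℝ, E) 𝓘(ℝ, E →L[ℝ] E →L[ℝ] ℝ) ∞ G p :=
    contMDiffAt_clm_of_apply fun u => contMDiffAt_clm_of_apply fun v =>
      SmoothAt.inner g (hconst u) (hconst v)
  have ha : ContMDiffAt 𝓘(ℝ, E) 𝓘(ℝ, E →L[ℝ] ℝ) ∞ a p :=
    contMDiffAt_clm_of_apply fun v => SmoothAt.covField_apply hα (hconst v)
  have hinv : ∀ x ∈ e.baseSet, ∃ T : E ≃L[ℝ] (E →L[ℝ] ℝ), (T : E →L[ℝ] E →L[ℝ] ℝ) = G x := by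
    intro x hx
    have hinj : Function.Injective (G x) := by
      rw [injective_iff_map_eq_zero]
      intro u hu
      by_contra hne
      have h1 : g.inner x (e.symmL ℝ x u) (e.symmL ℝ x u) = 0 := congrArg (fun T => T u) hu
      refine absurd h1 (g.pos x _ fun h0 => hne ?_).ne'
      rw [← e.continuousLinearMapAt_symmL (R := ℝ) hx u, h0, map_zero]
    have hd : Module.finrank ℝ E = Module.finrank ℝ (E →L[ℝ] ℝ) := by
      rw [← (LinearMap.toContinuousLinearMap (𝕜 := ℝ) (E := E) (F' := ℝ)).finrank_eq]
      exact (Subspace.dual_finrank_eq (K := ℝ) (V := E)).symm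
    exact ⟨(LinearEquiv.ofInjectiveOfFinrankEq (G x).toLinearMap hinj hd).toContinuousLinearEquiv,
      by ext; rfl⟩
  have hGinv : ContMDiffAt 𝓘(ℝ, E) 𝓘(ℝ, (E →L[ℝ] ℝ) →L[ℝ] E) ∞ (fun x => (G x).inverse) p := by
    obtain ⟨T, hT⟩ := hinv p (FiberBundle.mem_baseSet_trivializationAt' p)
    refine ContMDiffAt.comp p (g := ContinuousLinearMap.inverse) ?_ hG
    rw [← hT]
    exact (contDiffAt_map_inverse T).contMDiffAt
  refine (Bundle.contMDiffAt_section p).2 ?_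
  refine (hGinv.clm_apply ha).congr_of_eventuallyEq ?_
  filter_upwards [hbase] with x hx
  obtain ⟨T, hT⟩ := hinv x hx
  have hs : e.symmL ℝ x (e ⟨x, sharp g α x⟩).2 = sharp g α x := by
    rw [e.symmL_apply hx]
    exact e.symm_apply_apply_mk hx _
  have : G x (e ⟨x, sharp g α x⟩).2 = a x := by
    ext v
    change g.inner x (e.symmL ℝ x (e ⟨x, sharp g α x⟩).2) (e.symmL ℝ x v) = α x (e.symmL ℝ x v)
    rw [hs, inner_sharp]
  rw [← this, ← hT, ContinuousLinearMap.inverse_equiv]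
  simp [e]

end Smoothness

/-! ### Derivations and Lie brackets -/

section Calculus

variable {E : Type*} [NormedAddCommGroup E] [NormedSpace ℝ E] [CompleteSpace E]
  {M : Type*} [TopologicalSpace M] [ChartedSpace E M] [IsManifold 𝓘(ℝ, E) ∞ M]
  {p : M} {X Y Z : VField E M} {f : M → ℝ}

omit [CompleteSpace E] in
theorem SmoothAt.mdifferentiableAt (hX : SmoothAt X p) :
    MDifferentiableAt 𝓘(ℝ, E) 𝓘(ℝ, E).tangent (fun x => (X x : TangentBundle 𝓘(ℝ, E) M)) p :=
  ContMDiffAt.mdifferentiableAt hX (by simp)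

theorem bracket_add_left (hX : SmoothAt X p) (hY : SmoothAt Y p) :
    bracket (X + Y) Z p = bracket X Z p + bracket Y Z p := by
  have : IsManifold 𝓘(ℝ, E) 1 M := .of_le (n := ∞) (by simp)
  have : IsManifold 𝓘(ℝ, E) 2 M := .of_le (n := ∞) (by norm_cast)
  exact mlieBracket_add_left hX.mdifferentiableAt hY.mdifferentiableAt

theorem bracket_add_right (hY : SmoothAt Y p) (hZ : SmoothAt Z p) :
    bracket X (Y + Z) p = bracket X Y p + bracket X Z p := by
  have : IsManifold 𝓘(ℝ, E) 1 M := .of_le (n := ∞) (by simp)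
  have : IsManifold 𝓘(ℝ, E) 2 M := .of_le (n := ∞) (by norm_cast)
  exact mlieBracket_add_right hY.mdifferentiableAt hZ.mdifferentiableAt

theorem bracket_smul_right (hf : ContMDiffAt 𝓘(ℝ, E) 𝓘(ℝ, ℝ) ∞ f p) (hY : SmoothAt Y p) :
    bracket X (f • Y) p = der X f p • Y p + f p • bracket X Y p := by
  have : IsManifold 𝓘(ℝ, E) 1 M := .of_le (n := ∞) (by simp)
  have : IsManifold 𝓘(ℝ, E) 2 M := .of_le (n := ∞) (by norm_cast)
  exact mlieBracket_smul_right (hf.mdifferentiableAt (by simp)) hY.mdifferentiableAt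

theorem bracket_smul_left (hf : ContMDiffAt 𝓘(ℝ, E) 𝓘(ℝ, ℝ) ∞ f p) (hX : SmoothAt X p) :
    bracket (f • X) Y p = -der Y f p • X p + f p • bracket X Y p := by
  have : IsManifold 𝓘(ℝ, E) 1 M := .of_le (n := ∞) (by simp)
  have : IsManifold 𝓘(ℝ, E) 2 M := .of_le (n := ∞) (by norm_cast)
  exact mlieBracket_smul_left (hf.mdifferentiableAt (by simp)) hX.mdifferentiableAt

omit [CompleteSpace E] [IsManifold 𝓘(ℝ, E) ∞ M] in
theorem der_congr {f g : M → ℝ} (h : ∀ᶠ x in 𝓝 p, f x = g x) : der X f p = der X g p := by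
  rw [der, der, Filter.EventuallyEq.mfderiv_eq h]
  rfl

omit [CompleteSpace E] [IsManifold 𝓘(ℝ, E) ∞ M] in
theorem der_eq_zero {c : ℝ} (h : ∀ᶠ x in 𝓝 p, f x = c) : der X f p = 0 := by
  rw [der_congr h, der, mfderiv_const]
  rfl

omit [CompleteSpace E] [IsManifold 𝓘(ℝ, E) ∞ M] in
theorem der_neg : der X (fun x => -f x) p = -der X f p := by
  rw [der, der, show (fun x => -f x) = -f from rfl, mfderiv_neg]
  rfl

end Calculus

/-! ### The modified structure tensor of a quasi-Vaisman manifold -/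

section QuasiVaisman

variable {E : Type*} [NormedAddCommGroup E] [NormedSpace ℝ E] [FiniteDimensional ℝ E]
  {M : Type*} [TopologicalSpace M] [ChartedSpace E M] [IsManifold 𝓘(ℝ, E) ∞ M]
  {J : EndField E M} {g : RMetric E M} {θ : CovField E M}

omit [IsManifold 𝓘(ℝ, E) ∞ M] [FiniteDimensional ℝ E] in
theorem antiForm_apply (p : M) (u : TangentSpace 𝓘(ℝ, E) p) :
    antiForm J θ p u = -θ p (J p u) := rfl

omit [IsManifold 𝓘(ℝ, E) ∞ M] [FiniteDimensional ℝ E] in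
theorem form_J (p : M) (u : TangentSpace 𝓘(ℝ, E) p) : θ p (J p u) = -antiForm J θ p u := by
  rw [antiForm_apply, neg_neg]

namespace IsQuasiVaisman

variable (hM : IsQuasiVaisman J g θ)
include hM

theorem kerIsInvolutive : KerIsInvolutive θ := by
  intro p X Y hX hY hθX hθY
  have h := hM.closed p X Y hX hY
  rw [dOne, der_eq_zero hθY, der_eq_zero hθX] at h
  linarith

/-- The metric dual `V` of `η` is `J U`, where `U` is the metric dual of `θ`. -/
theorem sharp_antiForm (p : M) : sharp g (antiForm J θ) p = J p (sharp g θ p) := by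
  by_contra hne
  set w := sharp g (antiForm J θ) p - J p (sharp g θ p)
  refine (g.pos p w (sub_ne_zero.2 hne)).ne' ?_
  have h1 : g.inner p (J p (sharp g θ p)) w = -θ p (J p w) := by
    rw [← inner_sharp g θ, ← hM.hermitian.compat p _ (J p w), hM.hermitian.sq]
    simp
  have h2 : g.inner p (sharp g (antiForm J θ) p) w = -θ p (J p w) := by
    rw [inner_sharp]; rfl
  calc g.inner p w w = g.inner p (sharp g (antiForm J θ) p) w
        - g.inner p (J p (sharp g θ p)) w :=
          congrArg (fun T => T w) (map_sub (g.inner p) _ _)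
    _ = 0 := by rw [h1, h2, sub_self]

theorem form_sharp (p : M) : θ p (sharp g θ p) = 1 := by
  rw [← inner_sharp g θ, hM.unitary]

theorem antiForm_J (p : M) (u : TangentSpace 𝓘(ℝ, E) p) : antiForm J θ p (J p u) = θ p u := by
  rw [antiForm_apply, hM.hermitian.sq, map_neg, neg_neg]

theorem antiForm_sharp (p : M) : antiForm J θ p (sharp g θ p) = 0 := by
  have h1 := hM.hermitian.compat p (sharp g θ p) (J p (sharp g θ p))
  rw [hM.hermitian.sq, map_neg, g.symm, inner_sharp] at h1
  rw [antiForm_apply]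
  linarith

theorem form_J_sharp (p : M) : θ p (J p (sharp g θ p)) = 0 := by
  rw [form_J, hM.antiForm_sharp, neg_zero]

theorem antiForm_J_sharp (p : M) : antiForm J θ p (J p (sharp g θ p)) = 1 := by
  rw [hM.antiForm_J, hM.form_sharp]

theorem smoothCovField_antiForm : SmoothCovField (antiForm J θ) :=
  smoothCovField_of_apply fun _ _ hX =>
    (SmoothAt.covField_apply hM.smooth (hX.app hM.hermitian.smooth)).neg

/-- `[U, J X] = J [U, X]`. -/
theorem bracket_sharp_J {X : VField E M} {p : M} (hX : SmoothAt X p) :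
    bracket (sharp g θ) (app J X) p = J p (bracket (sharp g θ) X p) :=
  sub_eq_zero.1 (hM.holomorphic p X hX)

/-- `L_U η = 0`, in the form `U(η(X)) = η([U, X])`: both `θ` and `J` are invariant under `U`. -/
theorem der_sharp_antiForm {X : VField E M} {p : M} (hX : SmoothAt X p) :
    der (sharp g θ) (fun x => antiForm J θ x (X x)) p =
      antiForm J θ p (bracket (sharp g θ) X p) := by
  have h := hM.closed p (sharp g θ) (app J X) (smoothVField_sharp g hM.smooth p)
    (hX.app hM.hermitian.smooth)
  rw [dOne, der_eq_zero (c := 1) (.of_forall hM.form_sharp), hM.bracket_sharp_J hX, form_J] at h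
  have h2 : der (sharp g θ) (fun x => antiForm J θ x (X x)) p =
    -der (sharp g θ) (fun x => θ x (app J X x)) p := der_neg
  rw [h2]
  linarith

end IsQuasiVaisman

/-- The endomorphism field `J + η ⊗ U` of `M`, where `η = -θ ∘ J` and `U` is the metric dual of
`θ`. It preserves `ker θ`, vanishes on `V = J U`, and agrees with `J` on the orthogonal complement
of `⟨U, V⟩`, so that it restricts to the induced tensor `φ` on the leaves of `ker θ`. -/
noncomputable def phiField (J : EndField E M) (g : RMetric E M) (θ : CovField E M) : EndField E M :=
  fun x => J x + (antiForm J θ x).smulRight (sharp g θ x)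

theorem phiField_apply (p : M) (u : TangentSpace 𝓘(ℝ, E) p) :
    phiField J g θ p u = J p u + antiForm J θ p u • sharp g θ p := rfl

theorem app_phiField (X : VField E M) :
    app (phiField J g θ) X = app J X + (fun x => antiForm J θ x (X x)) • sharp g θ := rfl

namespace IsQuasiVaisman

variable (hM : IsQuasiVaisman J g θ)
include hM

theorem smoothAt_app_phiField {X : VField E M} {p : M} (hX : SmoothAt X p) :
    SmoothAt (app (phiField J g θ) X) p := by
  rw [app_phiField]
  exact (hX.app hM.hermitian.smooth).add
    (.smul (SmoothAt.covField_apply hM.smoothCovField_antiForm hX) (smoothVField_sharp g hM.smooth p))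

/-- The normality condition, on `M` and for vector fields tangent to `ker θ`. The `V`-component of
the torsion of `J + η ⊗ U` is `-dη(X, Y)`. Its `U`-component vanishes by `L_U η = 0` and by the
`θ`-component of `N_J = 0`, which is read off with `dθ(J X, J Y) = 0`. -/
theorem nijenhuis_phiField {X Y : VField E M} {p : M} (hX : SmoothAt X p) (hY : SmoothAt Y p)
    (hθX : ∀ᶠ x in 𝓝 p, θ x (X x) = 0) (hθY : ∀ᶠ x in 𝓝 p, θ x (Y x) = 0) :
    nijenhuis (phiField J g θ) X Y p +
      dOne (antiForm J θ) X Y p • sharp g (antiForm J θ) p = 0 := by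
  set U := sharp g θ with hUdef
  set η := antiForm J θ with hη
  have hU : SmoothAt U p := smoothVField_sharp g hM.smooth p
  have hJX := hX.app hM.hermitian.smooth
  have hJY := hY.app hM.hermitian.smooth
  have hfX := SmoothAt.covField_apply hM.smoothCovField_antiForm hX
  have hfY := SmoothAt.covField_apply hM.smoothCovField_antiForm hY
  rw [← hη] at hfX hfY
  have swap : ∀ A B : VField E M, bracket A B p = -bracket B A p :=
    fun A B => mlieBracket_swap_apply
  have self : ∀ A : VField E M, bracket A A p = 0 := fun A => by
    rw [bracket, mlieBracket_self]; rfl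
  have dsm : ∀ (f h : M → ℝ) , der (f • U) h p = f p * der U h p := fun f h =>
    map_smul (mfderiv 𝓘(ℝ, E) 𝓘(ℝ, ℝ) h p) (f p) (U p)
  have dadd : ∀ (A B : VField E M) (h : M → ℝ), der (A + B) h p = der A h p + der B h p :=
    fun A B h => map_add (mfderiv 𝓘(ℝ, E) 𝓘(ℝ, ℝ) h p) (A p) (B p)
  -- `N_J(X, Y) = 0`, solved for `[J X, J Y]`
  have hN := hM.hermitian.integrable p X Y hX hY
  rw [nijenhuis, hM.hermitian.sq] at hN
  have hd : bracket (app J X) (app J Y) p =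
      bracket X Y p + J p (bracket (app J X) Y p) + J p (bracket X (app J Y) p) := by
    rw [map_add] at hN
    rw [add_assoc, ← sub_eq_zero.1 hN]
    abel
  have hθ0 : θ p (bracket X Y p) = 0 := hM.kerIsInvolutive p X Y hX hY hθX hθY
  -- the `θ`-component of `N_J(X, Y) = 0`, combined with `dθ(J X, J Y) = 0`
  have hs : der (app J X) (fun x => η x (Y x)) p - der (app J Y) (fun x => η x (X x)) p =
      η p (bracket (app J X) Y p) + η p (bracket X (app J Y) p) := by
    have h := hM.closed p (app J X) (app J Y) hJX hJY
    have e1 : der (app J X) (fun x => η x (Y x)) p = -der (app J X) (fun x => θ x (app J Y x)) p :=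
      der_neg
    have e2 : der (app J Y) (fun x => η x (X x)) p = -der (app J Y) (fun x => θ x (app J X x)) p :=
      der_neg
    rw [dOne, hd, map_add, map_add, hθ0, form_J, form_J] at h
    rw [e1, e2]
    linarith
  have hφX : bracket (app (phiField J g θ) X) Y p = bracket (app J X) Y p
      + (-der Y (fun x => η x (X x)) p • U p + η p (X p) • bracket U Y p) := by
    rw [app_phiField, bracket_add_left hJX (.smul hfX hU), bracket_smul_left hfX hU]
  have hφY : bracket X (app (phiField J g θ) Y) p = bracket X (app J Y) p
      + (der X (fun x => η x (Y x)) p • U p - η p (Y p) • bracket U X p) := by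
    rw [app_phiField, bracket_add_right hJY (.smul hfY hU), bracket_smul_right hfY hU, swap X U]
    module
  have hφφ : bracket (app (phiField J g θ) X) (app (phiField J g θ) Y) p =
      bracket (app J X) (app J Y) p
      + (der (app J X) (fun x => η x (Y x)) p • U p - η p (Y p) • J p (bracket U X p))
      + (-der (app J Y) (fun x => η x (X x)) p • U p + η p (X p) • J p (bracket U Y p))
      + (η p (X p) * η p (bracket U Y p) - η p (Y p) * η p (bracket U X p)) • U p := by
    rw [app_phiField, app_phiField, bracket_add_left hJX (.smul hfX hU),
      bracket_add_right hJY (.smul hfY hU), bracket_smul_left hfX hU,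
      bracket_smul_right hfY hU, swap (app J X) U, bracket_add_right hJY (.smul hfY hU),
      bracket_smul_right hfY hU, self, hM.bracket_sharp_J hX, hM.bracket_sharp_J hY,
      dadd, dsm, hM.der_sharp_antiForm hX, hM.der_sharp_antiForm hY]
    module
  rw [nijenhuis, hφX, hφY, hφφ, hd, dOne, hM.sharp_antiForm]
  simp only [phiField_apply, map_add, map_sub, map_smul, hM.antiForm_sharp, hM.antiForm_J,
    hM.hermitian.sq, hθ0]
  have hηU : η p (U p) = 0 := hM.antiForm_sharp p
  simp only [← hUdef, ← hη, hηU, sub_eq_iff_eq_add.1 hs]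
  module

end IsQuasiVaisman
end QuasiVaisman

/-! ### The structure induced on an integral manifold -/

section Leaf

variable {E : Type*} [NormedAddCommGroup E] [NormedSpace ℝ E] [FiniteDimensional ℝ E]
  {M : Type*} [TopologicalSpace M] [ChartedSpace E M] [IsManifold 𝓘(ℝ, E) ∞ M]
  {F : Type*} [NormedAddCommGroup F] [NormedSpace ℝ F] [FiniteDimensional ℝ F]
  {L : Type*} [TopologicalSpace L] [ChartedSpace F L] [IsManifold 𝓘(ℝ, F) ∞ L]
  {J : EndField E M} {g : RMetric E M} {θ : CovField E M} {ι : L → M}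

omit [FiniteDimensional ℝ E] [FiniteDimensional ℝ F] [IsManifold 𝓘(ℝ, E) ∞ M]
  [IsManifold 𝓘(ℝ, F) ∞ L] in
theorem der_of_related {p : L} {X : VField F L} {X' : VField E M} {f : M → ℝ} {h : L → ℝ}
    (hι : ContMDiff 𝓘(ℝ, F) 𝓘(ℝ, E) ∞ ι) (hX : ∀ᶠ q in 𝓝 p, X' (ι q) = diff ι q (X q))
    (hf : ContMDiffAt 𝓘(ℝ, E) 𝓘(ℝ, ℝ) ∞ f (ι p)) (hh : ∀ᶠ q in 𝓝 p, h q = f (ι q)) :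
    der X h p = der X' f (ι p) := by
  rw [der_congr (g := f ∘ ι) hh, der, der, hX.self_of_nhds,
    mfderiv_comp (I' := 𝓘(ℝ, E)) p (hf.mdifferentiableAt (by simp))
      (hι.mdifferentiable (by simp) p)]
  rfl

omit [FiniteDimensional ℝ F] in
theorem exists_leftInverse_diff (hι : Manifold.IsImmersion 𝓘(ℝ, F) 𝓘(ℝ, E) ∞ ι) (p : L) :
    ∃ l : TangentSpace 𝓘(ℝ, E) (ι p) →L[ℝ] TangentSpace 𝓘(ℝ, F) p, ∀ u, l (diff ι p u) = u := by
  have : FiniteDimensional ℝ (TangentSpace 𝓘(ℝ, E) (ι p)) :=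
    inferInstanceAs (FiniteDimensional ℝ E)
  have : T2Space (TangentSpace 𝓘(ℝ, E) (ι p)) := inferInstanceAs (T2Space E)
  obtain ⟨l, hl⟩ := LinearMap.exists_leftInverse_of_injective
    (diff (E := E) (F := F) ι p).toLinearMap (LinearMap.ker_eq_bot.2 (diff_injective hι p))
  exact ⟨LinearMap.toContinuousLinearMap l, fun u => LinearMap.congr_fun hl u⟩

/-- The pullback `ι^* α` of a 1-form. -/
noncomputable def pullCov (ι : L → M) (α : CovField E M) : CovField F L :=
  fun p => (α (ι p)).comp (diff ι p)

omit [FiniteDimensional ℝ E] in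
theorem smoothCovField_pullCov (hι : Manifold.IsImmersion 𝓘(ℝ, F) 𝓘(ℝ, E) ∞ ι)
    {α : CovField E M} (hα : SmoothCovField α) :
    SmoothCovField (pullCov (F := F) ι α) := by
  refine smoothCovField_of_apply fun p X hX => ?_
  obtain ⟨X', hX', hXX'⟩ := exists_related_extension hι hX
  refine ((SmoothAt.covField_apply hα hX').comp p (hι.contMDiff p)).congr_of_eventuallyEq ?_
  filter_upwards [hXX'] with q hq
  exact congrArg (α (ι q)) hq.symm

/-- The pullback of a Riemannian metric by an immersion. -/
noncomputable def pullMetric (g : RMetric E M)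
    (hι : Manifold.IsImmersion 𝓘(ℝ, F) 𝓘(ℝ, E) ∞ ι) : RMetric F L where
  inner p := ContinuousLinearMap.bilinearComp (E := E) (F := E) (E' := F) (F' := F)
    (g.inner (ι p)) (diff ι p) (diff ι p)
  symm p v w := g.symm _ _ _
  pos p v hv := g.pos _ _ fun h0 =>
    hv (diff_injective hι p (h0.trans (map_zero (diff ι p)).symm))
  isVonNBounded p := by
    obtain ⟨l, hl⟩ := exists_leftInverse_diff hι p
    refine ((g.isVonNBounded (ι p)).image l).subset ?_
    exact fun v hv => ⟨diff ι p v, hv, hl v⟩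
  contMDiff p := by
    refine contMDiffAt_hom_of_apply (E := F) (G := F →L[ℝ] ℝ)
      (B := fun x : L => TangentSpace 𝓘(ℝ, F) x →L[ℝ] Bundle.Trivial L ℝ x) fun X hX =>
      contMDiffAt_hom_of_apply (E := F) (B := Bundle.Trivial L ℝ) fun Y hY =>
      contMDiffAt_trivial_section_iff.2 ?_
    obtain ⟨X', hX', hXX'⟩ := exists_related_extension hι hX
    obtain ⟨Y', hY', hYY'⟩ := exists_related_extension hι hY
    refine ((SmoothAt.inner g hX' hY').comp p (hι.contMDiff p)).congr_of_eventuallyEq ?_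
    filter_upwards [hXX', hYY'] with q hq hq'
    exact congrArg₂ (fun a b => g.inner (ι q) a b) hq.symm hq'.symm

theorem exists_isInduced (hM : IsQuasiVaisman J g θ) (hι : IsIntegralManifold F θ ι) :
    ∃ (φ : EndField F L) (ξ : VField F L) (η : CovField F L) (h : RMetric F L),
      IsInduced J g θ ι φ ξ η h := by
  have hV : ∀ p : L, θ (ι p) (sharp g (antiForm J θ) (ι p)) = 0 := fun p => by
    rw [hM.sharp_antiForm, hM.form_J_sharp]
  have hφ : ∀ (p : L) (u : TangentSpace 𝓘(ℝ, F) p),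
      θ (ι p) (phiField J g θ (ι p) (diff ι p u)) = 0 := by
    intro p u
    rw [phiField_apply, map_add, map_smul, hM.form_sharp, form_J]
    simp
  choose l hl using fun p : L => exists_leftInverse_diff hι.immersion p
  have hl' : ∀ (p : L) (w : TangentSpace 𝓘(ℝ, E) (ι p)), θ (ι p) w = 0 →
      diff ι p (l p w) = w := by
    intro p w hw
    obtain ⟨u, rfl⟩ := (hι.tangent p w).1 hw
    rw [hl]
  refine ⟨fun p => (l p).comp ((phiField J g θ (ι p)).comp (diff ι p)),
    fun p => l p (sharp g (antiForm J θ) (ι p)), pullCov ι (antiForm J θ),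
    pullMetric g hι.immersion, fun p => hl' p _ (hV p), fun _ _ => rfl,
    fun _ _ _ => rfl, fun p => ?_, fun p u h1 h2 => ?_⟩
  · rw [ContinuousLinearMap.comp_apply, ContinuousLinearMap.comp_apply, hl' p _ (hV p),
      phiField_apply, hM.sharp_antiForm, hM.hermitian.sq, hM.antiForm_J_sharp]
    simp
  · rw [g.symm, inner_sharp] at h2
    rw [ContinuousLinearMap.comp_apply, ContinuousLinearMap.comp_apply, hl' p _ (hφ p u),
      phiField_apply, h2]
    simp

namespace IsInduced

variable {φ : EndField F L} {ξ : VField F L} {η : CovField F L} {h : RMetric F L}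

omit [FiniteDimensional ℝ F] in
/-- Every tensor `φ` satisfying the defining conditions is the restriction of `J + η ⊗ U`: split
the tangent vector `u` as `(u - η(u) ξ) + η(u) ξ`. -/
theorem diff_phi (hM : IsQuasiVaisman J g θ) (hι : IsIntegralManifold F θ ι)
    (hi : IsInduced J g θ ι φ ξ η h) (p : L) (u : TangentSpace 𝓘(ℝ, F) p) :
    diff ι p (φ p u) = phiField J g θ (ι p) (diff ι p u) := by
  have hθ : ∀ w, θ (ι p) (diff ι p w) = 0 := fun w => (hι.tangent p _).2 ⟨w, rfl⟩
  have hd : diff ι p (u - η p u • ξ p) = diff ι p u - η p u • sharp g (antiForm J θ) (ι p) := by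
    rw [map_sub, map_smul, hi.xi]
  have h1 := hi.phi p (u - η p u • ξ p) (by rw [g.symm, inner_sharp, hθ]) (by
    rw [g.symm, inner_sharp, hd, map_sub, map_smul, hM.sharp_antiForm, hM.antiForm_J_sharp,
      ← hi.eta]
    simp)
  rw [hd, map_sub, map_smul, hi.phi_xi, smul_zero, sub_zero] at h1
  rw [h1, phiField_apply, ← hi.eta, hM.sharp_antiForm, map_sub, map_smul, hM.hermitian.sq]
  module

omit [FiniteDimensional ℝ F] in
theorem related_app_phi (hM : IsQuasiVaisman J g θ) (hι : IsIntegralManifold F θ ι)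
    (hi : IsInduced J g θ ι φ ξ η h) {p : L} {X : VField F L} {X' : VField E M}
    (hX : ∀ᶠ q in 𝓝 p, X' (ι q) = diff ι q (X q)) :
    ∀ᶠ q in 𝓝 p, app (phiField J g θ) X' (ι q) = diff ι q (app φ X q) := by
  filter_upwards [hX] with q hq
  exact (congrArg (phiField J g θ (ι q)) hq).trans (hi.diff_phi hM hι q (X q)).symm

theorem isAlmostContactMetric (hM : IsQuasiVaisman J g θ) (hι : IsIntegralManifold F θ ι)
    (hi : IsInduced J g θ ι φ ξ η h) : IsAlmostContactMetric φ ξ η h where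
  smooth_phi := smoothEndField_of_app fun p X hX => by
    obtain ⟨X', hX', hXX'⟩ := exists_related_extension hι.immersion hX
    exact smoothAt_of_related hι.immersion (hM.smoothAt_app_phiField hX')
      (hi.related_app_phi hM hι hXX')
  smooth_xi p := smoothAt_of_related hι.immersion
    (smoothVField_sharp g hM.smoothCovField_antiForm (ι p)) (.of_forall fun q => (hi.xi q).symm)
  smooth_eta := by
    have : η = pullCov ι (antiForm J θ) := by
      funext p
      ext u
      exact hi.eta p u
    rw [this]
    exact smoothCovField_pullCov hι.immersion hM.smoothCovField_antiForm
  sq p u := by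
    have hθ : θ (ι p) (diff ι p u) = 0 := (hι.tangent p _).2 ⟨u, rfl⟩
    apply diff_injective hι.immersion p
    rw [hi.diff_phi hM hι, hi.diff_phi hM hι, map_add, map_neg, map_smul, hi.xi, hi.eta,
      hM.sharp_antiForm]
    simp only [phiField_apply, map_add, map_smul, hM.hermitian.sq, hM.antiForm_J,
      hM.antiForm_sharp, hθ]
    module
  eta_xi p := by rw [hi.eta, hi.xi, hM.sharp_antiForm, hM.antiForm_J_sharp]
  compat p u v := by
    rw [hi.metric, hi.metric, hi.diff_phi hM hι, hi.diff_phi hM hι, hi.eta, hi.eta,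
      phiField_apply, phiField_apply]
    set a := diff (E := E) ι p u
    set b := diff (E := E) ι p v
    have h1 : g.inner (ι p) (sharp g θ (ι p)) (J (ι p) b) = -antiForm J θ (ι p) b := by
      rw [inner_sharp, form_J]
    have h2 : g.inner (ι p) (J (ι p) a) (sharp g θ (ι p)) = -antiForm J θ (ι p) a := by
      rw [g.symm, inner_sharp, form_J]
    simp only [map_add, map_smul, add_apply, smul_apply,
      h1, h2, hM.unitary, hM.hermitian.compat, smul_eq_mul]
    ring

theorem isQuasiSasakian (hM : IsQuasiVaisman J g θ) (hι : IsIntegralManifold F θ ι)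
    (hi : IsInduced J g θ ι φ ξ η h) : IsQuasiSasakian φ ξ η h where
  toIsAlmostContactMetric := hi.isAlmostContactMetric hM hι
  normal p X Y hX hY := by
    have hιs : ContMDiff 𝓘(ℝ, F) 𝓘(ℝ, E) ∞ ι := hι.immersion.contMDiff
    have hU := smoothVField_sharp g hM.smooth
    -- a related extension can be made tangent to `ker θ` everywhere by subtracting `θ(X') U`
    have key : ∀ {X : VField F L}, SmoothAt X p → ∃ X' : VField E M, SmoothAt X' (ι p) ∧
        (∀ᶠ q in 𝓝 p, X' (ι q) = diff ι q (X q)) ∧ ∀ x, θ x (X' x) = 0 := by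
      intro X hX
      obtain ⟨X', hX', hXX'⟩ := exists_related_extension hι.immersion hX
      refine ⟨X' + (fun x => -θ x (X' x)) • sharp g θ,
        hX'.add (.smul (SmoothAt.covField_apply hM.smooth hX').neg (hU _)), ?_, fun x => ?_⟩
      · filter_upwards [hXX'] with q hq
        have hθ : θ (ι q) (diff ι q (X q)) = 0 := (hι.tangent q _).2 ⟨X q, rfl⟩
        simp [hq, hθ]
      · simp [hM.form_sharp]
    obtain ⟨X', hX', hXX', hθX⟩ := key hX
    obtain ⟨Y', hY', hYY', hθY⟩ := key hY
    have hφX := hi.related_app_phi hM hι hXX'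
    have hφY := hi.related_app_phi hM hι hYY'
    have sφX' := hM.smoothAt_app_phiField hX'
    have sφY' := hM.smoothAt_app_phiField hY'
    have sφX := smoothAt_of_related hι.immersion sφX' hφX
    have sφY := smoothAt_of_related hι.immersion sφY' hφY
    have hη : ∀ {Z : VField F L} {Z' : VField E M},
        (∀ᶠ q in 𝓝 p, Z' (ι q) = diff (E := E) ι q (Z q)) →
        ∀ᶠ q in 𝓝 p, η q (Z q) = antiForm J θ (ι q) (Z' (ι q)) := by
      intro Z Z' hZ
      filter_upwards [hZ] with q hq
      rw [hq, hi.eta]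
    have hmain := hM.nijenhuis_phiField hX' hY' (.of_forall hθX) (.of_forall hθY)
    have hd : dOne η X Y p = dOne (antiForm J θ) X' Y' (ι p) := by
      rw [dOne, dOne, der_of_related hιs hXX'
          (SmoothAt.covField_apply hM.smoothCovField_antiForm hY') (hη hYY'),
        der_of_related hιs hYY'
          (SmoothAt.covField_apply hM.smoothCovField_antiForm hX') (hη hXX'),
        hi.eta, bracket_of_related hιs hX hY hX' hY' hXX' hYY']
    apply diff_injective hι.immersion p
    rw [map_zero, ← hmain, map_add, map_smul, hi.xi, hd, nijenhuis, nijenhuis, map_sub, map_add,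
      hi.diff_phi hM hι, hi.diff_phi hM hι, hi.diff_phi hM hι, map_add (diff ι p),
      bracket_of_related hιs hX hY hX' hY' hXX' hYY',
      bracket_of_related hιs sφX hY sφX' hY' hφX hYY',
      bracket_of_related hιs hX sφY hX' sφY' hXX' hφY,
      bracket_of_related hιs sφX sφY sφX' sφY' hφX hφY]
  d_fundamental p X Y Z hX hY hZ := by
    have hιs : ContMDiff 𝓘(ℝ, F) 𝓘(ℝ, E) ∞ ι := hι.immersion.contMDiff
    obtain ⟨X', hX', hXX'⟩ := exists_related_extension hι.immersion hX
    obtain ⟨Y', hY', hYY'⟩ := exists_related_extension hι.immersion hY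
    obtain ⟨Z', hZ', hZZ'⟩ := exists_related_extension hι.immersion hZ
    -- `Φ` is the pullback of `Ω`, since `g(u, U) = θ(u) = 0` for `u` tangent to the leaf
    have hΦ : ∀ q u v, fundamentalForm φ h q u v =
        fundamentalForm J g (ι q) (diff ι q u) (diff ι q v) := by
      intro q u v
      have hθ : θ (ι q) (diff ι q u) = 0 := (hι.tangent q _).2 ⟨u, rfl⟩
      rw [fundamentalForm, fundamentalForm, hi.metric, hi.diff_phi hM hι, phiField_apply, map_add,
        map_smul, g.symm _ (diff ι q u) (sharp g θ (ι q)), inner_sharp, hθ]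
      simp
    have hθ : ∀ u, θ (ι p) (diff ι p u) = 0 := fun u => (hι.tangent p _).2 ⟨u, rfl⟩
    have hder : ∀ {A B C : VField F L} {A' B' C' : VField E M},
        SmoothAt B' (ι p) → SmoothAt C' (ι p) →
        (∀ᶠ q in 𝓝 p, A' (ι q) = diff ι q (A q)) → (∀ᶠ q in 𝓝 p, B' (ι q) = diff ι q (B q)) →
        (∀ᶠ q in 𝓝 p, C' (ι q) = diff ι q (C q)) →
        der A (fun q => fundamentalForm φ h q (B q) (C q)) p =
          der A' (fun x => fundamentalForm J g x (B' x) (C' x)) (ι p) := by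
      intro A B C A' B' C' sB sC hA hB hC
      refine der_of_related hιs hA (SmoothAt.inner g sB (sC.app hM.hermitian.smooth)) ?_
      filter_upwards [hB, hC] with q hq hq'
      rw [hΦ, hq, hq']
    -- `dη ∧ θ` vanishes on vectors tangent to `ker θ`
    have hm := hM.d_fundamental (ι p) X' Y' Z' hX' hY' hZ'
    rw [dOneWedge, hXX'.self_of_nhds, hYY'.self_of_nhds, hZZ'.self_of_nhds, hθ, hθ, hθ] at hm
    rw [dTwo] at hm ⊢
    rw [hder hY' hZ' hXX' hYY' hZZ', hder hZ' hX' hYY' hZZ' hXX', hder hX' hY' hZZ' hXX' hYY',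
      hΦ, hΦ, hΦ, ← bracket_of_related hιs hX hY hX' hY' hXX' hYY',
      ← bracket_of_related hιs hY hZ hY' hZ' hYY' hZZ',
      ← bracket_of_related hιs hZ hX hZ' hX' hZZ' hXX',
      ← hXX'.self_of_nhds, ← hYY'.self_of_nhds, ← hZZ'.self_of_nhds, hm]
    ring

end IsInduced
end Leaf

end LeafGeometry

theorem mainTheorem11
    {E : Type*} [NormedAddCommGroup E] [NormedSpace ℝ E] [FiniteDimensional ℝ E]
    {M : Type*} [TopologicalSpace M] [T2Space M] [ChartedSpace E M] [IsManifold 𝓘(ℝ, E) ∞ M]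
    (J : EndField E M) (g : RMetric E M) (θ : CovField E M)
    (hM : IsQuasiVaisman J g θ) :
    KerIsInvolutive θ ∧
    ∀ (F : Type*) [NormedAddCommGroup F] [NormedSpace ℝ F] [FiniteDimensional ℝ F]
      (L : Type*) [TopologicalSpace L] [ChartedSpace F L] [IsManifold 𝓘(ℝ, F) ∞ L]
      (ι : L → M), IsLeaf F θ ι →
      (∃ (φ : EndField F L) (ξ : VField F L) (η : CovField F L) (h : RMetric F L),
        IsInduced J g θ ι φ ξ η h) ∧
      ∀ (φ : EndField F L) (ξ : VField F L) (η : CovField F L) (h : RMetric F L),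
        IsInduced J g θ ι φ ξ η h → IsQuasiSasakian φ ξ η h :=
  ⟨hM.kerIsInvolutive, fun _ _ _ _ _ _ _ _ _ hι =>
    ⟨exists_isInduced hM hι.toIsIntegralManifold, fun _ _ _ _ hi =>
      hi.isQuasiSasakian hM hι.toIsIntegralManifold⟩⟩
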